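/- **Setting.** A mechanism $M$ assigns to every database $x$ a probability measure $M(x)$ on a measurable output space. For a symmetric neighbouring relation on databases, $M$ is $(\varepsilon,\delta)$-DP if $M(x)(S)\le e^{\varepsilon}M(x')(S)+\delta$ for all neighbours $x,x'$ and all events $S$. For probability measures $P,Q$ the trade-off function $f_{P,Q}(t)$ is the infimum of the type-II error over all (randomized) tests of $P$ against $Q$ with type-I error at most $t$, and the privacy region of $(P,Q)$ is $\{(\beta_{\mathrm I},\beta_{\mathrm{II}}) : \beta_{\mathrm I}\in[0,1],\ f_{P,Q}(\beta_{\mathrm I})\le\beta_{\mathrm{II}}\le 1-\beta_{\mathrm I}\}$. Write $$\mathcal R(\varepsilon,\delta)=\{(\beta_{\mathrm I},\beta_{\mathrm{II}})\in[0,\infty)^2 : \beta_{\mathrm I}+\beta_{\mathrm{II}}\le 1,\ \beta_{\mathrm I}+e^{\varepsilon}\beta_{\mathrm{II}}\ge 1-\delta,\ e^{\varepsilon}\beta_{\mathrm I}+\beta_{\mathrm{II}}\ge 1-\delta\}.$$ In a $k$-fold adaptive composition, $k$ mechanisms are run in turn on the same database, the mechanism of each round may depend on the outputs of the previous rounds,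 and all $k$ outputs are released. It obeys a DP constraint in every round if the mechanism of each round satisfies that constraint for every value of the previous outputs. **Theorem.** Let $\varepsilon_1>\varepsilon_2\ge 0$, $0\le\delta_1<1$, $k\in\mathbb N$, and $$\delta_1\le\delta_2\le \delta_1+(1-\delta_1)\frac{e^{\varepsilon_1}-e^{\varepsilon_2}}{e^{\varepsilon_1}+1},\qquad \alpha=1-\frac{(\delta_2-\delta_1)(e^{\varepsilon_1}+1)}{(1-\delta_1)(e^{\varepsilon_1}-e^{\varepsilon_2})}\in[0,1].$$ For $u,v\in\{0,\dots,k\}$ let $\varepsilon_{u,v}=\varepsilon_1(u+v-k)+\varepsilon_2(u-v)$, $$B(\varepsilon_1,\varepsilon_2;u,v)=\Big\{(a,b,c,d)\in\{0,\dots,k\}^4 : a+b+c+d=k,\ (a+k-d-u-v)\varepsilon_1+(b+v-c-u)\varepsilon_2>0\Big\},$$ $$\delta_{u,v}=\sum_{(a,b,c,d)\in B(\varepsilon_1,\varepsilon_2;u,v)}\binom{k}{a,b,c,d}\Big(\frac{1-\alpha}{e^{\varepsilon_1}+1}\Big)^{a+d}\Big(\frac{\alpha}{e^{\varepsilon_2}+1}\Big)^{b+c}\Big(e^{a\varepsilon_1+b\varepsilon_2}-e^{(d+u+v-k)\varepsilon_1+(c+u-v)\varepsilon_2}\Big),$$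 with the convention $0^0=1$, and $$\mathcal R_k=\bigcap_{\substack{u,v\in\{0,\dots,k\}\\ u\ge\left\lceil\frac{k\varepsilon_1-v(\varepsilon_1-\varepsilon_2)}{\varepsilon_1+\varepsilon_2}\right\rceil}}\mathcal R\big(\varepsilon_{u,v},\,1-(1-\delta_1)^k(1-\delta_{u,v})\big).$$ Then: 1. For $u,v\in\{0,\dots,k\}$, $\varepsilon_{u,v}\ge 0$ if and only if $u\ge\left\lceil\frac{k\varepsilon_1-v(\varepsilon_1-\varepsilon_2)}{\varepsilon_1+\varepsilon_2}\right\rceil$. 2. There is a mechanism $M$ on two neighbouring databases $x,x'$, with finitely many outputs, that is both $(\varepsilon_1,\delta_1)$-DP and $(\varepsilon_2,\delta_2)$-DP, such that the privacy region of its $k$-fold composition with itself, that is of the pair $(M(x)^{\otimes k},M(x')^{\otimes k})$, is exactly $\mathcal R_k$; the same holds with $x$ and $x'$ exchanged. 3. $\mathcal R_k$ is the largest possible region: for every $k$-fold adaptive composition that obeys both the $(\varepsilon_1,\delta_1)$-DP and the $(\varepsilon_2,\delta_2)$-DP constraint in every round, and for all neighbouring databases $x,x'$, the privacy region of the pair of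 joint output laws under $x$ and $x'$ is contained in $\mathcal R_k$. -/

import Mathlib

open MeasureTheory ProbabilityTheory

universe u v

namespace TwoDP

/-! ### Differential privacy and hypothesis testing -/

/-- A mechanism `M` assigns to every database `x : X` the law of its output. It is
`(ε, δ)`-differentially private for the neighbouring relation `nbr` if
`M x S ≤ e ^ ε * M x' S + δ` for all neighbours `x`, `x'` and all events `S`. -/
def IsDP {X : Type u} {Y : Type v} [MeasurableSpace Y] (nbr : X → X → Prop)
    (M : X → Measure Y) (ε δ : ℝ) : Prop :=
  ∀ x x', nbr x x' → ∀ S, MeasurableSet S →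
    (M x).real S ≤ Real.exp ε * (M x').real S + δ

/-- A (randomized) test: `φ y` is the probability of rejecting the null hypothesis
after observing `y`. -/
def IsTest {Y : Type v} [MeasurableSpace Y] (φ : Y → ℝ) : Prop :=
  Measurable φ ∧ ∀ y, 0 ≤ φ y ∧ φ y ≤ 1

/-- The type-I error of the test `φ` when the null hypothesis is `P`. -/
noncomputable def typeI {Y : Type v} [MeasurableSpace Y] (P : Measure Y) (φ : Y → ℝ) : ℝ :=
  ∫ y, φ y ∂P

/-- The type-II error of the test `φ` when the alternative is `Q`. -/
noncomputable def typeII {Y : Type v} [MeasurableSpace Y] (Q : Measure Y) (φ : Y → ℝ) : ℝ :=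
  ∫ y, (1 - φ y) ∂Q

/-- The trade-off function of the testing problem `P` against `Q`: the least type-II error
among all tests with type-I error at most `t`. -/
noncomputable def tradeoff {Y : Type v} [MeasurableSpace Y] (P Q : Measure Y) (t : ℝ) : ℝ :=
  sInf {β | ∃ φ : Y → ℝ, IsTest φ ∧ typeI P φ ≤ t ∧ β = typeII Q φ}

/-- The privacy region of the testing problem `P` against `Q`: all error pairs
`(β_I, β_II)` with `β_I ∈ [0, 1]` and `tradeoff P Q β_I ≤ β_II ≤ 1 - β_I`. -/
def privacyRegion {Y : Type v} [MeasurableSpace Y] (P Q : Measure Y) : Set (ℝ × ℝ) :=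
  {p | 0 ≤ p.1 ∧ p.1 ≤ 1 ∧ tradeoff P Q p.1 ≤ p.2 ∧ p.2 ≤ 1 - p.1}

/-- The privacy region of the single constraint `(ε, δ)`. -/
def dpRegion (ε δ : ℝ) : Set (ℝ × ℝ) :=
  {p | 0 ≤ p.1 ∧ 0 ≤ p.2 ∧ p.1 + p.2 ≤ 1 ∧
    1 - δ ≤ p.1 + Real.exp ε * p.2 ∧ 1 - δ ≤ Real.exp ε * p.1 + p.2}

/-! ### Composition -/

/-- The space of the outputs of the first `n` rounds, round `i` having outputs in `Y i`. -/
def View (Y : ℕ → Type v) : ℕ → Type v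
  | 0 => PUnit
  | n + 1 => View Y n × Y n

instance View.instMeasurableSpace (Y : ℕ → Type v) [∀ i, MeasurableSpace (Y i)] :
    ∀ n, MeasurableSpace (View Y n)
  | 0 => inferInstanceAs (MeasurableSpace PUnit)
  | n + 1 =>
    @Prod.instMeasurableSpace (View Y n) (Y n) (View.instMeasurableSpace Y n) inferInstance

/-- The joint law of the first `n` outputs when the output of round `i`, given the previous
outputs `w`, has law `κ i w`. -/
noncomputable def adaptiveLaw {Y : ℕ → Type v} [∀ i, MeasurableSpace (Y i)]
    (κ : ∀ i, Kernel (View Y i) (Y i)) : ∀ n, Measure (View Y n)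
  | 0 => Measure.dirac PUnit.unit
  | n + 1 => adaptiveLaw κ n ⊗ₘ κ n

/-- The `k`-fold adaptive composition of the mechanisms `M 0, …, M (k - 1)`, where the mechanism
of round `i` may depend on the outputs of the previous rounds. -/
noncomputable def composition {X : Type u} {Y : ℕ → Type v} [∀ i, MeasurableSpace (Y i)]
    (M : ∀ i, X → Kernel (View Y i) (Y i)) (k : ℕ) (x : X) : Measure (View Y k) :=
  adaptiveLaw (fun i => M i x) k

/-- The `k`-fold composition of a mechanism with itself: `k` independent outputs. -/
noncomputable def selfComposition {X : Type u} {Z : Type v} [MeasurableSpace Z]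
    (M : X → Measure Z) (k : ℕ) (x : X) : Measure (View (fun _ => Z) k) :=
  composition (Y := fun _ => Z) (fun _ x => Kernel.const _ (M x)) k x

/-! ### The explicit region -/

/-- The weight `α` of the second constraint. -/
noncomputable def weight (ε₁ δ₁ ε₂ δ₂ : ℝ) : ℝ :=
  1 - (δ₂ - δ₁) * (Real.exp ε₁ + 1) / ((1 - δ₁) * (Real.exp ε₁ - Real.exp ε₂))

/-- The slope `ε_{u,v} = ε₁ (u + v - k) + ε₂ (u - v)`. -/
def slope (ε₁ ε₂ : ℝ) (k u v : ℕ) : ℝ :=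
  ε₁ * ((u : ℝ) + v - k) + ε₂ * ((u : ℝ) - v)

/-- The set `B(ε₁, ε₂; u, v)` of all `n = (a, b, c, d)` with `a + b + c + d = k` and
`(a + k - d - u - v) ε₁ + (b + v - c - u) ε₂ > 0`. -/
noncomputable def indexSet (ε₁ ε₂ : ℝ) (k u v : ℕ) : Finset (Fin 4 → ℕ) :=
  open Classical in
  (Finset.univ.piAntidiag k).filter fun n =>
    0 < ((n 0 : ℝ) + k - n 3 - u - v) * ε₁ + ((n 1 : ℝ) + v - n 2 - u) * ε₂

/-- The offset `δ_{u,v}`, for `n = (a, b, c, d)`. -/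
noncomputable def offset (ε₁ δ₁ ε₂ δ₂ : ℝ) (k u v : ℕ) : ℝ :=
  ∑ n ∈ indexSet ε₁ ε₂ k u v,
    (Nat.multinomial Finset.univ n : ℝ) *
      ((1 - weight ε₁ δ₁ ε₂ δ₂) / (Real.exp ε₁ + 1)) ^ (n 0 + n 3) *
      (weight ε₁ δ₁ ε₂ δ₂ / (Real.exp ε₂ + 1)) ^ (n 1 + n 2) *
      (Real.exp (n 0 * ε₁ + n 1 * ε₂) -
        Real.exp (((n 3 : ℝ) + u + v - k) * ε₁ + ((n 2 : ℝ) + u - v) * ε₂))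

/-- The pairs `(u, v)` with `u, v ∈ {0, …, k}` and
`u ≥ ⌈(k ε₁ - v (ε₁ - ε₂)) / (ε₁ + ε₂)⌉`. -/
def slopeIndices (ε₁ ε₂ : ℝ) (k : ℕ) : Set (ℕ × ℕ) :=
  {q | q.1 ≤ k ∧ q.2 ≤ k ∧ ⌈(k * ε₁ - q.2 * (ε₁ - ε₂)) / (ε₁ + ε₂)⌉ ≤ (q.1 : ℤ)}

/-- The intersection of the regions of the constraints
`(ε_{u,v}, 1 - (1 - δ₁) ^ k (1 - δ_{u,v}))`. -/
def optimalRegion (ε₁ δ₁ ε₂ δ₂ : ℝ) (k : ℕ) : Set (ℝ × ℝ) :=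
  {p | ∀ q ∈ slopeIndices ε₁ ε₂ k,
    p ∈ dpRegion (slope ε₁ ε₂ k q.1 q.2)
      (1 - (1 - δ₁) ^ k * (1 - offset ε₁ δ₁ ε₂ δ₂ k q.1 q.2))}

end TwoDP

/-! The set of error pairs of all tests of P against Q is convex, so up to domination it is
determined by the least values of `a * typeI + b * typeII` for `a, b ≥ 0`. For discrete laws this
Bayes error is `∑ min (a P) (b Q)`; for k-fold products it is `overlap`, defined by peeling off one
round at a time.

One round: the two constraints, used in both directions, bound the error pair by four half-planes.
Over the polygon they cut out of the positive quadrant, `a x + b y` is at least the overlap of an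
explicit mixture of randomized responses of levels ε₁ and ε₂ with total mass 1 - δ₁
(`sum_min_weights_le`). The weight α is the one for which this mixture, together with an outcome of
mass δ₁ that reveals the database, meets the ε₂-constraint with offset exactly δ₂.

Many rounds: conditioning a test on the history and integrating the one-round bound reproduces the
recursion of `overlap` (`overlap_le_adaptiveLaw`), so no adaptive composition beats the product of
the extremal mechanism. Conversely, on the finite output space of that product, Hahn-Banach produces
a test below every point satisfying all the linear bounds (`exists_isTest_of_sum_min_le`).

Explicit form: by homogeneity only `t ↦ overlap k 1 t` matters. It is piecewise linear, with its
breakpoints among the numbers `exp ε_{u,v}`, and its value there is `(1 - δ₁)^k (1 - δ_{u,v})`.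
Symmetry under exchanging the databases disposes of negative slopes, so the finitely many
constraints in `optimalRegion` encode all supporting lines (`mem_optimalRegion_iff`). -/

namespace TwoDP

/-! ### The overlap of two product distributions -/

/-- The overlap `∑ min (a * p y) (b * q y)` of the `n`-fold products of the weights `p` and `q`,
scaled by `a` and `b`. -/
noncomputable def overlap {ι : Type*} [Fintype ι] (p q : ι → ℝ) : ℕ → ℝ → ℝ → ℝ
  | 0, a, b => min a b
  | n + 1, a, b => ∑ i, overlap p q n (a * p i) (b * q i)

theorem overlap_comm {ι : Type*} [Fintype ι] {p q : ι → ℝ} (e : Equiv.Perm ι)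
    (hp : ∀ i, p (e i) = q i) (hq : ∀ i, q (e i) = p i) (n : ℕ) (a b : ℝ) :
    overlap p q n a b = overlap p q n b a := by
  induction n generalizing a b with
  | zero => exact min_comm a b
  | succ n ih =>
    simp only [overlap]
    rw [← Equiv.sum_comp e fun i => overlap p q n (b * p i) (a * q i)]
    exact Finset.sum_congr rfl fun i _ => by rw [ih, hp, hq]

theorem overlap_swap {ι : Type*} [Fintype ι] (p q : ι → ℝ) (n : ℕ) (a b : ℝ) :
    overlap q p n a b = overlap p q n b a := by
  induction n generalizing a b with
  | zero => exact min_comm a b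
  | succ n ih => simp only [overlap, ih]

theorem overlap_mul {ι : Type*} [Fintype ι] (p q : ι → ℝ) (n : ℕ) {c : ℝ} (hc : 0 ≤ c)
    (a b : ℝ) : overlap p q n (c * a) (c * b) = c * overlap p q n a b := by
  induction n generalizing a b with
  | zero => exact (mul_min_of_nonneg a b hc).symm
  | succ n ih => simp only [overlap, mul_assoc, ih, Finset.mul_sum]

theorem overlap_zero_left {ι : Type*} [Fintype ι] (p : ι → ℝ) {q : ι → ℝ} (hq : ∀ i, 0 ≤ q i)
    (n : ℕ) {b : ℝ} (hb : 0 ≤ b) : overlap p q n 0 b = 0 := by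
  induction n generalizing b with
  | zero => exact min_eq_left hb
  | succ n ih => simp [overlap, ih (mul_nonneg hb (hq _))]

theorem overlap_zero_right {ι : Type*} [Fintype ι] {p : ι → ℝ} (q : ι → ℝ) (hp : ∀ i, 0 ≤ p i)
    (n : ℕ) {a : ℝ} (ha : 0 ≤ a) : overlap p q n a 0 = 0 := by
  induction n generalizing a with
  | zero => exact min_eq_right ha
  | succ n ih => simp [overlap, ih (mul_nonneg ha (hp _))]

/-- Outcomes that are impossible under one of the two hypotheses do not contribute. -/
theorem overlap_eq_of_zero {m : ℕ} {p q : Fin (m + 2) → ℝ} (hp : ∀ i, 0 ≤ p i)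
    (hq : ∀ i, 0 ≤ q i) (hq0 : q 0 = 0) (hp0 : p (Fin.last _) = 0) (n : ℕ) {a b : ℝ}
    (ha : 0 ≤ a) (hb : 0 ≤ b) :
    overlap p q n a b =
      overlap (fun i : Fin m => p i.castSucc.succ) (fun i => q i.castSucc.succ) n a b := by
  induction n generalizing a b with
  | zero => rfl
  | succ n ih =>
    simp only [overlap]
    rw [Fin.sum_univ_succ, hq0, mul_zero, overlap_zero_right q hp n (mul_nonneg ha (hp _)),
      zero_add, Fin.sum_univ_castSucc, Fin.succ_last, hp0, mul_zero,
      overlap_zero_left p hq n (mul_nonneg hb (hq _)), add_zero]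
    exact Finset.sum_congr rfl fun i _ => ih (mul_nonneg ha (hp _)) (mul_nonneg hb (hq _))

/-- Pascal's rule for multinomial coefficients in summed form: expand `(∑ X i) ^ (n + 1)` directly
and as `(∑ X i) ^ n * ∑ X i`, then apply the linear functional that sends the monomial with exponent
`m` to `F m`. -/
theorem sum_multinomial_succ {ι : Type*} [Fintype ι] [DecidableEq ι] (n : ℕ)
    (F : (ι → ℕ) → ℝ) :
    ∑ m ∈ Finset.univ.piAntidiag (n + 1), (Nat.multinomial Finset.univ m : ℝ) * F m =
      ∑ m ∈ Finset.univ.piAntidiag n, (Nat.multinomial Finset.univ m : ℝ) *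
        ∑ i, F (m + Pi.single i 1) := by
  let L : MvPolynomial ι ℝ →ₗ[ℝ] ℝ :=
    (MvPolynomial.basisMonomials ι ℝ).constr ℝ fun s => F s
  have hmon (m : ι → ℕ) : ∏ i, (MvPolynomial.X i : MvPolynomial ι ℝ) ^ m i =
      MvPolynomial.monomial (Finsupp.equivFunOnFinite.symm m) 1 := by
    rw [MvPolynomial.monomial_eq, Finsupp.prod_fintype _ _ fun i => pow_zero _]
    simp
  have hL (m : ι → ℕ) : L (∏ i, MvPolynomial.X i ^ m i) = F m := by
    have hb := (MvPolynomial.basisMonomials ι ℝ).constr_basis ℝ (fun s => F s)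
      (Finsupp.equivFunOnFinite.symm m)
    rw [MvPolynomial.coe_basisMonomials] at hb
    rw [hmon]
    exact hb
  have hpow (N : ℕ) : (∑ i, (MvPolynomial.X i : MvPolynomial ι ℝ)) ^ N =
      ∑ m ∈ Finset.univ.piAntidiag N,
        (Nat.multinomial Finset.univ m : ℝ) • ∏ i, MvPolynomial.X i ^ m i := by
    rw [Finset.sum_pow_eq_sum_piAntidiag]
    refine Finset.sum_congr rfl fun m _ => ?_
    rw [Nat.cast_smul_eq_nsmul, nsmul_eq_mul]
  have hX (m : ι → ℕ) (i : ι) : (∏ j, (MvPolynomial.X j : MvPolynomial ι ℝ) ^ m j) *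
      MvPolynomial.X i = ∏ j, MvPolynomial.X j ^ (m + Pi.single i 1 : ι → ℕ) j := by
    simp only [Pi.add_apply, pow_add, Finset.prod_mul_distrib]
    congr 1
    rw [Finset.prod_eq_single i] <;> simp +contextual
  have h := congrArg L ((hpow (n + 1)).symm.trans
    ((pow_succ _ n).trans (congrArg (· * ∑ i, MvPolynomial.X i) (hpow n))))
  simp only [Finset.mul_sum]
  rw [Finset.sum_comm]
  simpa only [Finset.sum_mul, Finset.mul_sum, smul_mul_assoc, hX, map_sum, map_smul, hL,
    smul_eq_mul] using h

/-- Outcome sequences with the same counts `m` have the same mass under each hypothesis, so the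
overlap can be grouped by counts. -/
theorem overlap_eq_sum {ι : Type*} [Fintype ι] [DecidableEq ι] (p q : ι → ℝ) (n : ℕ) (a b : ℝ) :
    overlap p q n a b = ∑ m ∈ Finset.univ.piAntidiag n, (Nat.multinomial Finset.univ m : ℝ) *
      min (a * ∏ i, p i ^ m i) (b * ∏ i, q i ^ m i) := by
  induction n generalizing a b with
  | zero => simp [overlap, Nat.multinomial]
  | succ n ih =>
    rw [sum_multinomial_succ]
    simp only [overlap, ih]
    rw [Finset.sum_comm]
    refine Finset.sum_congr rfl fun m _ => ?_
    rw [Finset.mul_sum]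
    refine Finset.sum_congr rfl fun i _ => ?_
    have key (r : ι → ℝ) :
        ∏ j, r j ^ (m + Pi.single i 1 : ι → ℕ) j = r i * ∏ j, r j ^ m j := by
      simp only [Pi.add_apply, pow_add, Finset.prod_mul_distrib]
      rw [mul_comm]
      congr 1
      rw [Finset.prod_eq_single i] <;> simp +contextual
    rw [key, key, mul_assoc, mul_assoc]

/-- A concave piecewise linear function lies below a line with non-negative coefficients
if it does so at its breakpoints. -/
theorem sum_mul_min_le_of_breakpoints {ι : Type*} (s : Finset ι) (C g : ι → ℝ)
    (hg : ∀ i ∈ s, 0 ≤ g i) {x y : ℝ} (hx : 0 ≤ x) (hy : 0 ≤ y)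
    (h : ∀ j ∈ s, ∑ i ∈ s, C i * min (g i) (g j) ≤ x + g j * y) {t : ℝ} (ht : 0 ≤ t) :
    ∑ i ∈ s, C i * min (g i) t ≤ x + t * y := by
  classical
  -- The point 0 is added so that every `t ≥ 0` has an element of `S` at or below it; the sum
  -- vanishes there.
  let S := insert 0 (s.image g)
  have hS : ∀ r ∈ S, ∑ i ∈ s, C i * min (g i) r ≤ x + r * y := by
    intro r hr
    rcases Finset.mem_insert.1 hr with rfl | hr
    · rw [Finset.sum_eq_zero fun i hi => by rw [min_eq_right (hg i hi), mul_zero]]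
      simpa using hx
    · obtain ⟨j, hj, rfl⟩ := Finset.mem_image.1 hr
      exact h j hj
  have hgS : ∀ i ∈ s, g i ∈ S := fun i hi =>
    Finset.mem_insert_of_mem (Finset.mem_image_of_mem g hi)
  have hlo : (S.filter (· ≤ t)).Nonempty := ⟨0, by simp [S, ht]⟩
  obtain ⟨lo, hlo, hmax⟩ := Finset.exists_max_image _ id hlo
  obtain ⟨hloS, hlot⟩ := Finset.mem_filter.1 hlo
  have hlow : ∀ i ∈ s, g i ≤ t → g i ≤ lo := fun i hi hit =>
    hmax _ (Finset.mem_filter.2 ⟨hgS i hi, hit⟩)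
  by_cases hne : (S.filter (t < ·)).Nonempty
  · obtain ⟨hi, hhi, hmin⟩ := Finset.exists_min_image _ id hne
    obtain ⟨hhiS, hhit⟩ := Finset.mem_filter.1 hhi
    have hd : 0 < hi - lo := by linarith
    -- No `g i` lies strictly between `lo` and `hi`, so the sum is affine on this interval;
    -- interpolation needs no sign condition on `C`.
    have hcomb : (hi - lo) * ∑ i ∈ s, C i * min (g i) t =
        (hi - t) * ∑ i ∈ s, C i * min (g i) lo + (t - lo) * ∑ i ∈ s, C i * min (g i) hi := by
      simp only [Finset.mul_sum, ← Finset.sum_add_distrib]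
      refine Finset.sum_congr rfl fun i his => ?_
      rcases le_or_gt (g i) t with hit | hit
      · rw [min_eq_left hit, min_eq_left (hlow i his hit), min_eq_left (hit.trans hhit.le)]
        ring
      · have : hi ≤ g i := hmin _ (Finset.mem_filter.2 ⟨hgS i his, hit⟩)
        rw [min_eq_right hit.le, min_eq_right (hlot.trans hit.le), min_eq_right this]
        ring
    have h1 := mul_le_mul_of_nonneg_left (hS lo hloS) (sub_nonneg.2 hhit.le)
    have h2 := mul_le_mul_of_nonneg_left (hS hi hhiS) (sub_nonneg.2 hlot)
    refine le_of_mul_le_mul_left ?_ hd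
    calc _ ≤ _ := hcomb.le.trans (add_le_add h1 h2)
      _ = _ := by ring
  -- Past the last breakpoint the sum is constant, while the line does not decrease because `0 ≤ y`.
  · have hall : ∀ i ∈ s, g i ≤ t := fun i hi => by
      by_contra hlt
      exact hne ⟨g i, Finset.mem_filter.2 ⟨hgS i hi, not_le.1 hlt⟩⟩
    calc _ = ∑ i ∈ s, C i * min (g i) lo := Finset.sum_congr rfl fun i hi => by
          rw [min_eq_left (hall i hi), min_eq_left (hlow i hi (hall i hi))]
      _ ≤ x + lo * y := hS lo hloS
      _ ≤ _ := by gcongr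

/-! ### Tests and densities -/

section Tests

variable {Ω : Type*} [MeasurableSpace Ω]

theorem IsTest.one_sub {φ : Ω → ℝ} (hφ : IsTest φ) : IsTest fun w => 1 - φ w :=
  ⟨measurable_const.sub hφ.1, fun w => ⟨sub_nonneg.2 (hφ.2 w).2, sub_le_self _ (hφ.2 w).1⟩⟩

theorem IsTest.norm_le {φ : Ω → ℝ} (hφ : IsTest φ) (w : Ω) : ‖φ w‖ ≤ 1 := by
  rw [Real.norm_of_nonneg (hφ.2 w).1]
  exact (hφ.2 w).2

theorem IsTest.integrable {φ : Ω → ℝ} (hφ : IsTest φ) (P : Measure Ω) [IsFiniteMeasure P] :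
    Integrable φ P :=
  .of_bound hφ.1.aestronglyMeasurable 1 (ae_of_all _ hφ.norm_le)

theorem IsTest.integrable_mul {φ p : Ω → ℝ} {μ : Measure Ω} (hφ : IsTest φ)
    (hp : Integrable p μ) : Integrable (fun w => p w * φ w) μ :=
  hp.mul_bdd (c := 1) hφ.1.aestronglyMeasurable (ae_of_all _ hφ.norm_le)

theorem IsTest.integral_mem {φ : Ω → ℝ} (hφ : IsTest φ) (P : Measure Ω)
    [IsProbabilityMeasure P] : 0 ≤ ∫ w, φ w ∂P ∧ ∫ w, φ w ∂P ≤ 1 := by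
  refine ⟨integral_nonneg fun w => (hφ.2 w).1, ?_⟩
  calc _ ≤ ∫ _, (1 : ℝ) ∂P :=
        integral_mono (hφ.integrable P) (integrable_const _) fun w => (hφ.2 w).2
    _ = 1 := by simp

theorem isTest_indicator {S : Set Ω} (hS : MeasurableSet S) :
    IsTest (S.indicator fun _ => (1 : ℝ)) := by
  refine ⟨measurable_const.indicator hS, fun w => ?_⟩
  by_cases h : w ∈ S <;> simp [h]

/-- Two finite measures have densities with respect to a common measure. -/
theorem exists_common_density (P Q : Measure Ω) [IsFiniteMeasure P] [IsFiniteMeasure Q] :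
    ∃ (μ : Measure Ω) (p q : Ω → ℝ), Measurable p ∧ Measurable q ∧ (∀ w, 0 ≤ p w) ∧
      (∀ w, 0 ≤ q w) ∧ Integrable p μ ∧ Integrable q μ ∧
      (∀ f : Ω → ℝ, ∫ w, f w ∂P = ∫ w, p w * f w ∂μ) ∧
      ∀ f : Ω → ℝ, ∫ w, f w ∂Q = ∫ w, q w * f w ∂μ := by
  have hP : P ≪ P + Q := Measure.absolutelyContinuous_of_le (Measure.le_add_right le_rfl)
  have hQ : Q ≪ P + Q := Measure.absolutelyContinuous_of_le (Measure.le_add_left le_rfl)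
  exact ⟨P + Q, fun w => (P.rnDeriv (P + Q) w).toReal, fun w => (Q.rnDeriv (P + Q) w).toReal,
    (Measure.measurable_rnDeriv _ _).ennreal_toReal,
    (Measure.measurable_rnDeriv _ _).ennreal_toReal, fun _ => ENNReal.toReal_nonneg,
    fun _ => ENNReal.toReal_nonneg, Measure.integrable_toReal_rnDeriv,
    Measure.integrable_toReal_rnDeriv, fun f => (integral_rnDeriv_smul hP).symm,
    fun f => (integral_rnDeriv_smul hQ).symm⟩

/-- A differential privacy constraint on events extends to randomized tests. -/
theorem IsTest.integral_le_of_measureReal_le {P Q : Measure Ω} [IsFiniteMeasure P]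
    [IsFiniteMeasure Q] {c δ : ℝ} (h : ∀ S, MeasurableSet S → P.real S ≤ c * Q.real S + δ)
    {φ : Ω → ℝ} (hφ : IsTest φ) : ∫ w, φ w ∂P ≤ c * ∫ w, φ w ∂Q + δ := by
  obtain ⟨μ, p, q, hpm, hqm, -, -, hpi, hqi, hP, hQ⟩ := exists_common_density P Q
  -- Neyman-Pearson: the indicator of this set maximizes `∫ φ dP - c ∫ φ dQ` over all tests, so the
  -- constraint on this one event suffices.
  have hS : MeasurableSet {w | c * q w ≤ p w} := measurableSet_le (hqm.const_mul c) hpm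
  have hψ := isTest_indicator hS
  set ψ := {w | c * q w ≤ p w}.indicator fun _ => (1 : ℝ) with hψd
  have hPS : P.real {w | c * q w ≤ p w} = ∫ w, ψ w ∂P := (integral_indicator_one hS).symm
  have hQS : Q.real {w | c * q w ≤ p w} = ∫ w, ψ w ∂Q := (integral_indicator_one hS).symm
  have hle : ∫ w, (p w * φ w - c * (q w * φ w)) ∂μ ≤
      ∫ w, (p w * ψ w - c * (q w * ψ w)) ∂μ := by
    refine integral_mono ((hφ.integrable_mul hpi).sub ((hφ.integrable_mul hqi).const_mul c))
      ((hψ.integrable_mul hpi).sub ((hψ.integrable_mul hqi).const_mul c)) fun w => ?_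
    obtain ⟨h0, h1⟩ := hφ.2 w
    by_cases hw : c * q w ≤ p w
    · have : ψ w = 1 := Set.indicator_of_mem (s := {w | c * q w ≤ p w}) hw _
      simp only [this]
      nlinarith
    · have : ψ w = 0 := Set.indicator_of_notMem (s := {w | c * q w ≤ p w}) hw _
      simp only [this]
      nlinarith
  rw [integral_sub (hφ.integrable_mul hpi) ((hφ.integrable_mul hqi).const_mul c),
    integral_sub (hψ.integrable_mul hpi) ((hψ.integrable_mul hqi).const_mul c),
    integral_const_mul, integral_const_mul, ← hP, ← hQ, ← hP, ← hQ, ← hPS, ← hQS] at hle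
  linarith [h _ hS]

/-- If the conditional errors `f w` and `g w` dominate an overlap for every `w`, their integrals
dominate the errors of tests of `P` against `Q`, one for each summand of the overlap. -/
theorem exists_tests_sum_le {ι : Type*} [Fintype ι] (P Q : Measure Ω) [IsFiniteMeasure P]
    [IsFiniteMeasure Q] {p q : ι → ℝ} {f g : Ω → ℝ} (hf : IsTest f) (hg : IsTest g)
    (h : ∀ w a b, 0 ≤ a → 0 ≤ b → ∑ i, min (a * p i) (b * q i) ≤ a * f w + b * g w)
    {a b : ℝ} (ha : 0 ≤ a) (hb : 0 ≤ b) :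
    ∃ ψ : ι → Ω → ℝ, (∀ i, IsTest (ψ i)) ∧
      ∑ i, (a * p i * typeI P (ψ i) + b * q i * typeII Q (ψ i)) ≤
        a * ∫ w, f w ∂P + b * ∫ w, g w ∂Q := by
  obtain ⟨μ, r, s, hrm, hsm, hr0, hs0, hri, hsi, hP, hQ⟩ := exists_common_density P Q
  have hS (i : ι) : MeasurableSet {w | a * r w * p i ≤ b * s w * q i} :=
    measurableSet_le ((hrm.const_mul a).mul_const _) ((hsm.const_mul b).mul_const _)
  -- The Bayes test for the i-th summand: pointwise it picks the smaller of the two weighted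
  -- densities and so attains the minimum.
  refine ⟨fun i => {w | a * r w * p i ≤ b * s w * q i}.indicator fun _ => 1,
    fun i => isTest_indicator (hS i), ?_⟩
  set ψ : ι → Ω → ℝ := fun i => {w | a * r w * p i ≤ b * s w * q i}.indicator fun _ => 1
  have hψ (i : ι) : IsTest (ψ i) := isTest_indicator (hS i)
  have hI (i : ι) : Integrable (fun w => a * p i * (r w * ψ i w)) μ :=
    ((hψ i).integrable_mul hri).const_mul _
  have hJ (i : ι) : Integrable (fun w => b * q i * (s w * (1 - ψ i w))) μ :=
    ((hψ i).one_sub.integrable_mul hsi).const_mul _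
  calc ∑ i, (a * p i * typeI P (ψ i) + b * q i * typeII Q (ψ i))
      = ∫ w, ∑ i, (a * p i * (r w * ψ i w) + b * q i * (s w * (1 - ψ i w))) ∂μ := by
        rw [integral_finsetSum _ fun i _ => by exact (hI i).add (hJ i)]
        refine Finset.sum_congr rfl fun i _ => ?_
        rw [integral_add (hI i) (hJ i), integral_const_mul, integral_const_mul, ← hP,
          ← hQ fun w => 1 - ψ i w]
        rfl
    _ ≤ ∫ w, (a * (r w * f w) + b * (s w * g w)) ∂μ := by
        refine integral_mono (integrable_finsetSum _ fun i _ => (hI i).add (hJ i))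
          (((hf.integrable_mul hri).const_mul a).add ((hg.integrable_mul hsi).const_mul b))
          fun w => ?_
        have hw := h w (a * r w) (b * s w) (mul_nonneg ha (hr0 w)) (mul_nonneg hb (hs0 w))
        refine le_trans (Finset.sum_le_sum fun i _ => ?_)
          (hw.trans_eq (by ring))
        by_cases hi : a * r w * p i ≤ b * s w * q i
        · have : ψ i w = 1 := Set.indicator_of_mem (s := {w | a * r w * p i ≤ b * s w * q i}) hi _
          rw [this, min_eq_left hi]
          exact le_of_eq (by ring)
        · have : ψ i w = 0 :=
            Set.indicator_of_notMem (s := {w | a * r w * p i ≤ b * s w * q i}) hi _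
          rw [this, min_eq_right (not_le.1 hi).le]
          exact le_of_eq (by ring)
    _ = a * ∫ w, f w ∂P + b * ∫ w, g w ∂Q := by
        rw [integral_add ((hf.integrable_mul hri).const_mul a)
          ((hg.integrable_mul hsi).const_mul b), integral_const_mul, integral_const_mul, ← hP, ← hQ]

theorem typeII_eq {Q : Measure Ω} [IsProbabilityMeasure Q] {φ : Ω → ℝ} (hφ : IsTest φ) :
    typeII Q φ = 1 - ∫ w, φ w ∂Q := by
  rw [typeII, integral_sub (integrable_const _) (hφ.integrable Q)]
  simp

theorem le_typeI_add_of_measureReal_le {P Q : Measure Ω} [IsProbabilityMeasure P]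
    [IsProbabilityMeasure Q] {c δ : ℝ}
    (h : ∀ S, MeasurableSet S → P.real S ≤ c * Q.real S + δ) {φ : Ω → ℝ} (hφ : IsTest φ) :
    1 - δ ≤ typeI P φ + c * typeII Q φ := by
  -- The constraint is applied to the acceptance probability `1 - φ`.
  have h1 := hφ.one_sub.integral_le_of_measureReal_le h
  have h2 := typeII_eq (Q := P) hφ
  simp only [typeII] at h2 ⊢
  simp only [typeI]
  linarith

theorem le_add_typeII_of_measureReal_le {P Q : Measure Ω} [IsProbabilityMeasure P]
    [IsProbabilityMeasure Q] {c δ : ℝ}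
    (h : ∀ S, MeasurableSet S → Q.real S ≤ c * P.real S + δ) {φ : Ω → ℝ} (hφ : IsTest φ) :
    1 - δ ≤ c * typeI P φ + typeII Q φ := by
  have h1 := hφ.integral_le_of_measureReal_le h
  rw [typeII_eq hφ, typeI]
  linarith

/-- The points above a linear lower bound for the errors of all tests contain the
privacy region. -/
theorem le_of_mem_privacyRegion {P Q : Measure Ω} {a b c : ℝ} (ha : 0 ≤ a) (hb : 0 < b)
    (h : ∀ φ : Ω → ℝ, IsTest φ → c ≤ a * typeI P φ + b * typeII Q φ) {z : ℝ × ℝ}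
    (hz : z ∈ privacyRegion P Q) : c ≤ a * z.1 + b * z.2 := by
  obtain ⟨h0, -, h2, -⟩ := hz
  have hle : (c - a * z.1) / b ≤ tradeoff P Q z.1 := by
    -- The test that never rejects has type-I error 0, so the infimum runs over a nonempty set.
    refine le_csInf ⟨_, fun _ => 0, ⟨measurable_const, by simp⟩, by simpa [typeI] using h0, rfl⟩ ?_
    rintro _ ⟨φ, hφ, hφz, rfl⟩
    rw [div_le_iff₀ hb]
    linarith [h φ hφ, mul_le_mul_of_nonneg_left hφz ha]
  have := (div_le_iff₀ hb).1 (hle.trans h2)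
  linarith

theorem nonneg_of_mem_privacyRegion {P Q : Measure Ω} {z : ℝ × ℝ}
    (hz : z ∈ privacyRegion P Q) : 0 ≤ z.2 := by
  have := le_of_mem_privacyRegion (c := 0) le_rfl one_pos (fun φ hφ => by
    have : 0 ≤ typeII Q φ := integral_nonneg fun w => sub_nonneg.2 (hφ.2 w).2
    linarith) hz
  linarith

end Tests

/-! ### Adaptive compositions -/

theorem isProbabilityMeasure_adaptiveLaw {Y : ℕ → Type*} [∀ i, MeasurableSpace (Y i)]
    {κ : ∀ i, Kernel (View Y i) (Y i)} {k : ℕ} (hκ : ∀ i < k, IsMarkovKernel (κ i)) :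
    IsProbabilityMeasure (adaptiveLaw κ k) := by
  induction k with
  | zero => exact inferInstanceAs (IsProbabilityMeasure (Measure.dirac PUnit.unit))
  | succ k ih =>
    have := ih fun i hi => hκ i (hi.trans k.lt_succ_self)
    have := hκ k k.lt_succ_self
    exact inferInstanceAs (IsProbabilityMeasure (adaptiveLaw κ k ⊗ₘ κ k))

/-- A bound on the errors of the tests in every round gives the corresponding bound
for the adaptive composition. -/
theorem overlap_le_adaptiveLaw {ι : Type*} [Fintype ι] {p q : ι → ℝ} (hp : ∀ i, 0 ≤ p i)
    (hq : ∀ i, 0 ≤ q i) {Y : ℕ → Type*} [∀ i, MeasurableSpace (Y i)]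
    {κ η : ∀ i, Kernel (View Y i) (Y i)} {k : ℕ} (hκ : ∀ i < k, IsMarkovKernel (κ i))
    (hη : ∀ i < k, IsMarkovKernel (η i))
    (h : ∀ i < k, ∀ w (φ : Y i → ℝ), IsTest φ → ∀ a b, 0 ≤ a → 0 ≤ b →
      ∑ j, min (a * p j) (b * q j) ≤ a * typeI (κ i w) φ + b * typeII (η i w) φ)
    {φ : View Y k → ℝ} (hφ : IsTest φ) {a b : ℝ} (ha : 0 ≤ a) (hb : 0 ≤ b) :
    overlap p q k a b ≤ a * typeI (adaptiveLaw κ k) φ + b * typeII (adaptiveLaw η k) φ := by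
  induction k generalizing a b with
  | zero =>
    have h1 : typeI (adaptiveLaw κ 0) φ = φ PUnit.unit :=
      integral_dirac' (α := PUnit) φ _ hφ.1.stronglyMeasurable
    have h2 : typeII (adaptiveLaw η 0) φ = 1 - φ PUnit.unit :=
      integral_dirac' (α := PUnit) (fun w => 1 - φ w) _ hφ.one_sub.1.stronglyMeasurable
    rw [h1, h2]
    obtain ⟨h0, h1⟩ := hφ.2 PUnit.unit
    simp only [overlap]
    nlinarith [min_le_left a b, min_le_right a b]
  | succ k ih =>
    have hκ' : ∀ i < k, IsMarkovKernel (κ i) := fun i hi => hκ i (hi.trans k.lt_succ_self)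
    have hη' : ∀ i < k, IsMarkovKernel (η i) := fun i hi => hη i (hi.trans k.lt_succ_self)
    have := isProbabilityMeasure_adaptiveLaw hκ'
    have := isProbabilityMeasure_adaptiveLaw hη'
    have := isProbabilityMeasure_adaptiveLaw hκ
    have := isProbabilityMeasure_adaptiveLaw hη
    have := hκ k k.lt_succ_self
    have := hη k k.lt_succ_self
    have hsec (w : View Y k) : IsTest fun y => φ (w, y) :=
      ⟨hφ.1.comp measurable_prodMk_left, fun y => hφ.2 _⟩
    have hf : IsTest fun w => typeI (κ k w) fun y => φ (w, y) :=
      ⟨(StronglyMeasurable.integral_kernel_prod_right (κ := κ k) (f := fun w y => φ (w, y))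
        hφ.1.stronglyMeasurable).measurable, fun w => (hsec w).integral_mem _⟩
    have hg : IsTest fun w => typeII (η k w) fun y => φ (w, y) :=
      ⟨(StronglyMeasurable.integral_kernel_prod_right (κ := η k) (f := fun w y => 1 - φ (w, y))
        hφ.one_sub.1.stronglyMeasurable).measurable, fun w => (hsec w).one_sub.integral_mem _⟩
    -- Given the history `w`, the section of `φ` is a test in the last round. Its conditional errors
    -- obey the one-round bound for all nonnegative weights, in particular for `a` and `b` times the
    -- densities of the two history laws at `w`.
    obtain ⟨ψ, hψ, hle⟩ := exists_tests_sum_le (adaptiveLaw κ k) (adaptiveLaw η k) hf hg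
      (fun w a b ha hb => h k k.lt_succ_self w _ (hsec w) a b ha hb) ha hb
    have h1 : typeI (adaptiveLaw κ (k + 1)) φ =
        ∫ w, typeI (κ k w) (fun y => φ (w, y)) ∂adaptiveLaw κ k :=
      Measure.integral_compProd (hφ.integrable (adaptiveLaw κ (k + 1)))
    have h2 : typeII (adaptiveLaw η (k + 1)) φ =
        ∫ w, typeII (η k w) (fun y => φ (w, y)) ∂adaptiveLaw η k :=
      Measure.integral_compProd (hφ.one_sub.integrable (adaptiveLaw η (k + 1)))
    rw [h1, h2]
    refine le_trans (Finset.sum_le_sum fun i _ => ?_) hle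
    -- The weights `a * p i` and `b * q i` are those in the recursion of `overlap`.
    exact ih hκ' hη' (fun i hi => h i (hi.trans k.lt_succ_self)) (hψ i)
      (mul_nonneg ha (hp i)) (mul_nonneg hb (hq i))

/-! ### The extremal single-round weights -/

/-- The weights under the null hypothesis of the four outcomes of the extremal mechanism which are
possible under both hypotheses. -/
noncomputable def nullWeights (ε₁ ε₂ r s : ℝ) : Fin 4 → ℝ :=
  ![r * Real.exp ε₁, s * Real.exp ε₂, s, r]

/-- The weights under the alternative of the four outcomes of the extremal mechanism which are
possible under both hypotheses. -/
noncomputable def altWeights (ε₁ ε₂ r s : ℝ) : Fin 4 → ℝ :=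
  ![r, s, s * Real.exp ε₂, r * Real.exp ε₁]

theorem nullWeights_nonneg {ε₁ ε₂ r s : ℝ} (hr : 0 ≤ r) (hs : 0 ≤ s) (i : Fin 4) :
    0 ≤ nullWeights ε₁ ε₂ r s i := by
  fin_cases i <;> simp [nullWeights] <;> positivity

theorem altWeights_nonneg {ε₁ ε₂ r s : ℝ} (hr : 0 ≤ r) (hs : 0 ≤ s) (i : Fin 4) :
    0 ≤ altWeights ε₁ ε₂ r s i := by
  fin_cases i <;> simp [altWeights] <;> positivity

theorem overlap_weights_comm (ε₁ ε₂ r s : ℝ) (n : ℕ) (a b : ℝ) :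
    overlap (nullWeights ε₁ ε₂ r s) (altWeights ε₁ ε₂ r s) n a b =
      overlap (nullWeights ε₁ ε₂ r s) (altWeights ε₁ ε₂ r s) n b a :=
  overlap_comm Fin.revPerm (fun i => by fin_cases i <;> rfl) (fun i => by fin_cases i <;> rfl) n a b

theorem prod_nullWeights (ε₁ ε₂ r s : ℝ) (m : Fin 4 → ℕ) :
    ∏ i, nullWeights ε₁ ε₂ r s i ^ m i =
      r ^ (m 0 + m 3) * s ^ (m 1 + m 2) * Real.exp (m 0 * ε₁ + m 1 * ε₂) := by
  rw [Fin.prod_univ_four, Real.exp_add, Real.exp_nat_mul, Real.exp_nat_mul]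
  simp only [nullWeights, Matrix.cons_val, mul_pow, pow_add]
  ring

theorem prod_altWeights (ε₁ ε₂ r s : ℝ) (m : Fin 4 → ℕ) :
    ∏ i, altWeights ε₁ ε₂ r s i ^ m i =
      r ^ (m 0 + m 3) * s ^ (m 1 + m 2) * Real.exp (m 3 * ε₁ + m 2 * ε₂) := by
  rw [Fin.prod_univ_four, Real.exp_add, Real.exp_nat_mul, Real.exp_nat_mul]
  simp only [altWeights, Matrix.cons_val, mul_pow, pow_add]
  ring

/-- The error pair `(x, y)` of a test obeying two privacy constraints in both directions lies above
the extremal overlap, for slopes on one side of the diagonal. -/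
theorem sum_min_le_of_le {E₁ E₂ r s x y a b : ℝ} (hE₂ : 1 ≤ E₂) (hE : E₂ < E₁)
    (h1 : r * (E₁ + 1) + s * (E₂ + 1) ≤ x + E₁ * y)
    (h2 : r * (E₂ + 1) + s * (E₂ + 1) ≤ x + E₂ * y)
    (h2' : r * (E₂ + 1) + s * (E₂ + 1) ≤ E₂ * x + y)
    (hy : 0 ≤ y) (ha : 0 ≤ a) (hab : a ≤ b) :
    min (a * (r * E₁)) (b * r) + min (a * (s * E₂)) (b * s) + min (a * s) (b * (s * E₂)) +
      min (a * r) (b * (r * E₁)) ≤ a * x + b * y := by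
  have hb : 0 ≤ b := ha.trans hab
  have m1 : min (a * (r * E₁)) (b * r) ≤ a * (r * E₁) := min_le_left _ _
  have m1' : min (a * (r * E₁)) (b * r) ≤ b * r := min_le_right _ _
  have m2 : min (a * (s * E₂)) (b * s) ≤ a * (s * E₂) := min_le_left _ _
  have m2' : min (a * (s * E₂)) (b * s) ≤ b * s := min_le_right _ _
  have m3 : min (a * s) (b * (s * E₂)) ≤ a * s := min_le_left _ _
  have m4 : min (a * r) (b * (r * E₁)) ≤ a * r := min_le_left _ _
  -- The three ranges of `b / a` correspond to the vertices of the polygon of admissible error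
  -- pairs: `a x + b y` is a nonnegative combination of the two constraints meeting at the
  -- minimizing vertex. Here these are `h1` and `0 ≤ y`.
  rcases le_total (a * E₁) b with hc | hc
  · have := mul_le_mul_of_nonneg_left h1 ha
    have := mul_le_mul_of_nonneg_right hc hy
    linarith
  -- In the middle range, `(E₁ - E₂)(a x + b y) = (b - a E₂)(x + E₁ y) + (a E₁ - b)(x + E₂ y)`.
  rcases le_total (a * E₂) b with hd | hd
  · have k1 := mul_le_mul_of_nonneg_left h1 (sub_nonneg.2 hd)
    have k2 := mul_le_mul_of_nonneg_left h2 (sub_nonneg.2 hc)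
    suffices b * r + a * (s * E₂) + a * s + a * r ≤ a * x + b * y by linarith
    refine le_of_mul_le_mul_left ?_ (sub_pos.2 hE)
    linarith
  · suffices b * r + b * s + a * s + a * r ≤ a * x + b * y by linarith
    -- Near the diagonal, `(E₂² - 1)(a x + b y) = (b E₂ - a)(x + E₂ y) + (a E₂ - b)(E₂ x + y)`. This
    -- degenerates for `E₂ = 1`, where the range shrinks to `a = b`.
    rcases hE₂.eq_or_lt with rfl | hlt
    · have : a = b := le_antisymm hab (by linarith)
      subst this
      have := mul_le_mul_of_nonneg_left h2 ha
      linarith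
    · have k1 := mul_le_mul_of_nonneg_left h2
        (show 0 ≤ b * E₂ - a by nlinarith)
      have k2 := mul_le_mul_of_nonneg_left h2' (sub_nonneg.2 hd)
      have hpos : 0 < (E₂ - 1) * (E₂ + 1) := by nlinarith
      refine le_of_mul_le_mul_left ?_ hpos
      linarith

theorem sum_min_weights_le {ε₁ ε₂ r s x y a b : ℝ} (hε₂ : 0 ≤ ε₂) (hε : ε₂ < ε₁)
    (h1 : r * (Real.exp ε₁ + 1) + s * (Real.exp ε₂ + 1) ≤ x + Real.exp ε₁ * y)
    (h1' : r * (Real.exp ε₁ + 1) + s * (Real.exp ε₂ + 1) ≤ Real.exp ε₁ * x + y)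
    (h2 : r * (Real.exp ε₂ + 1) + s * (Real.exp ε₂ + 1) ≤ x + Real.exp ε₂ * y)
    (h2' : r * (Real.exp ε₂ + 1) + s * (Real.exp ε₂ + 1) ≤ Real.exp ε₂ * x + y)
    (hx : 0 ≤ x) (hy : 0 ≤ y) (ha : 0 ≤ a) (hb : 0 ≤ b) :
    ∑ i, min (a * nullWeights ε₁ ε₂ r s i) (b * altWeights ε₁ ε₂ r s i) ≤ a * x + b * y := by
  have hE₂ := Real.one_le_exp hε₂
  have hE := Real.exp_lt_exp.2 hε
  rw [Fin.sum_univ_four]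
  simp only [nullWeights, altWeights, Matrix.cons_val]
  rcases le_total a b with hab | hab
  · exact sum_min_le_of_le hE₂ hE h1 h2 h2' hy ha hab
  -- Exchanging the two kinds of error permutes the four weights and reduces to `a ≤ b`.
  · have := sum_min_le_of_le hE₂ hE (h1'.trans_eq (add_comm _ _))
      (h2'.trans_eq (add_comm _ _)) (h2.trans_eq (add_comm _ _)) hx hb hab
    rw [min_comm (b * _), min_comm (b * _), min_comm (b * _), min_comm (b * _)] at this
    linarith

/-! ### The explicit region -/

theorem mem_slopeIndices_iff {ε₁ ε₂ : ℝ} (hε₂ : 0 ≤ ε₂) (hε : ε₂ < ε₁) {k a b : ℕ} :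
    (a, b) ∈ slopeIndices ε₁ ε₂ k ↔ a ≤ k ∧ b ≤ k ∧ 0 ≤ slope ε₁ ε₂ k a b := by
  have hpos : 0 < ε₁ + ε₂ := by linarith
  simp only [slopeIndices, Set.mem_ofPred_eq, Int.ceil_le, Int.cast_natCast, div_le_iff₀ hpos, slope]
  refine and_congr_right fun _ => and_congr_right fun _ => ?_
  constructor <;> intro h <;> linarith

/-- The right side is the log-likelihood ratio of an outcome sequence with counts `m`; this is why
the slopes `ε_{u,v}`, with `u = a + b` and `v = a + c`, contain all breakpoints of the overlap. -/
theorem slope_of_sum_eq (ε₁ ε₂ : ℝ) {k : ℕ} {m : Fin 4 → ℕ} (hm : ∑ i, m i = k) :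
    slope ε₁ ε₂ k (m 0 + m 1) (m 0 + m 2) =
      (m 0 * ε₁ + m 1 * ε₂) - (m 3 * ε₁ + m 2 * ε₂) := by
  rw [Fin.sum_univ_four] at hm
  subst hm
  simp only [slope]
  push_cast
  ring

theorem slope_sub {ε₁ ε₂ : ℝ} {k a b : ℕ} (ha : a ≤ k) (hb : b ≤ k) :
    slope ε₁ ε₂ k (k - a) (k - b) = -slope ε₁ ε₂ k a b := by
  simp only [slope]
  push_cast [ha, hb]
  ring

/-- The probability scale of the outcomes with likelihood ratio `e ^ (± ε₁)` in the extremal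
mechanism. -/
noncomputable def outerScale (ε₁ δ₁ ε₂ δ₂ : ℝ) : ℝ :=
  (1 - δ₁) * ((1 - weight ε₁ δ₁ ε₂ δ₂) / (Real.exp ε₁ + 1))

/-- The probability scale of the outcomes with likelihood ratio `e ^ (± ε₂)` in the extremal
mechanism. -/
noncomputable def innerScale (ε₁ δ₁ ε₂ δ₂ : ℝ) : ℝ :=
  (1 - δ₁) * (weight ε₁ δ₁ ε₂ δ₂ / (Real.exp ε₂ + 1))

/-- The overlap of the `k`-fold products of the extremal weights. -/
noncomputable def extremalOverlap (ε₁ δ₁ ε₂ δ₂ : ℝ) : ℕ → ℝ → ℝ → ℝ :=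
  overlap (nullWeights ε₁ ε₂ (outerScale ε₁ δ₁ ε₂ δ₂) (innerScale ε₁ δ₁ ε₂ δ₂))
    (altWeights ε₁ ε₂ (outerScale ε₁ δ₁ ε₂ δ₂) (innerScale ε₁ δ₁ ε₂ δ₂))

section Scales

variable {ε₁ δ₁ ε₂ δ₂ : ℝ}

theorem scales_sum (ε₁ δ₁ ε₂ δ₂ : ℝ) : outerScale ε₁ δ₁ ε₂ δ₂ * (Real.exp ε₁ + 1) +
    innerScale ε₁ δ₁ ε₂ δ₂ * (Real.exp ε₂ + 1) = 1 - δ₁ := by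
  have h1 : Real.exp ε₁ + 1 ≠ 0 := by positivity
  have h2 : Real.exp ε₂ + 1 ≠ 0 := by positivity
  simp only [outerScale, innerScale]
  field_simp
  ring

/-- The equation that determines α: lowering the level from ε₁ to ε₂ costs the extremal mechanism
exactly `δ₂ - δ₁` in the offset. -/
theorem outerScale_mul_sub (hε : ε₂ < ε₁) (hδ₁ : δ₁ < 1) :
    outerScale ε₁ δ₁ ε₂ δ₂ * (Real.exp ε₁ - Real.exp ε₂) = δ₂ - δ₁ := by
  have h1 : Real.exp ε₁ + 1 ≠ 0 := by positivity
  have h2 : Real.exp ε₁ - Real.exp ε₂ ≠ 0 := (sub_pos.2 (Real.exp_lt_exp.2 hε)).ne'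
  have h3 : 1 - δ₁ ≠ 0 := (sub_pos.2 hδ₁).ne'
  simp only [outerScale, weight]
  field_simp
  ring

theorem outerScale_nonneg (hε : ε₂ < ε₁) (hδ₁ : δ₁ < 1) (hδ : δ₁ ≤ δ₂) :
    0 ≤ outerScale ε₁ δ₁ ε₂ δ₂ := by
  refine nonneg_of_mul_nonneg_left ?_ (sub_pos.2 (Real.exp_lt_exp.2 hε))
  rw [outerScale_mul_sub hε hδ₁]
  exact sub_nonneg.2 hδ

theorem innerScale_nonneg (hε : ε₂ < ε₁) (hδ₁ : δ₁ < 1)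
    (hact : δ₂ ≤ δ₁ + (1 - δ₁) * (Real.exp ε₁ - Real.exp ε₂) / (Real.exp ε₁ + 1)) :
    0 ≤ innerScale ε₁ δ₁ ε₂ δ₂ := by
  have h2 : 0 < Real.exp ε₁ - Real.exp ε₂ := sub_pos.2 (Real.exp_lt_exp.2 hε)
  have h1 : 0 < Real.exp ε₁ + 1 := by positivity
  have h3 : 0 < 1 - δ₁ := sub_pos.2 hδ₁
  have h4 : (δ₂ - δ₁) * (Real.exp ε₁ + 1) ≤ (1 - δ₁) * (Real.exp ε₁ - Real.exp ε₂) :=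
    (le_div_iff₀ h1).1 (by linarith)
  have h5 : 0 ≤ weight ε₁ δ₁ ε₂ δ₂ := by
    rw [weight, sub_nonneg]
    exact div_le_one_of_le₀ h4 (by positivity)
  rw [innerScale]
  positivity

theorem extremalOverlap_comm (n : ℕ) (a b : ℝ) :
    extremalOverlap ε₁ δ₁ ε₂ δ₂ n a b = extremalOverlap ε₁ δ₁ ε₂ δ₂ n b a :=
  overlap_weights_comm _ _ _ _ n a b

/-- The offset `δ_{u,v}` in terms of the overlap at slope `ε_{u,v}`. -/
theorem extremalOverlap_slope (hr : 0 ≤ outerScale ε₁ δ₁ ε₂ δ₂)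
    (hs : 0 ≤ innerScale ε₁ δ₁ ε₂ δ₂) (k u v : ℕ) :
    extremalOverlap ε₁ δ₁ ε₂ δ₂ k 1 (Real.exp (slope ε₁ ε₂ k u v)) =
      (1 - δ₁) ^ k * (1 - offset ε₁ δ₁ ε₂ δ₂ k u v) := by
  have htot : (1 - δ₁) ^ k = ∑ m ∈ Finset.univ.piAntidiag k,
      (Nat.multinomial Finset.univ m : ℝ) * ∏ i, nullWeights ε₁ ε₂ (outerScale ε₁ δ₁ ε₂ δ₂)
        (innerScale ε₁ δ₁ ε₂ δ₂) i ^ m i := by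
    rw [← Finset.sum_pow_eq_sum_piAntidiag, Fin.sum_univ_four, ← scales_sum ε₁ δ₁ ε₂ δ₂]
    simp only [nullWeights, Matrix.cons_val]
    ring
  -- Since `min P (t Q) = P - max (P - t Q) 0`, the offset must be the positive part divided by `(1
  -- - δ₁) ^ k`; `indexSet` selects the counts with `P / Q > t`, apart from the common scale
  -- factors.
  rw [mul_sub, mul_one, eq_sub_iff_add_eq]
  refine Eq.trans ?_ htot.symm
  rw [extremalOverlap, overlap_eq_sum, offset, indexSet,
    Finset.sum_filter, Finset.mul_sum, ← Finset.sum_add_distrib]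
  refine Finset.sum_congr rfl fun m hm => ?_
  have hk : ∑ i, m i = k := (Finset.mem_piAntidiag.1 hm).1
  rw [Fin.sum_univ_four] at hk
  rw [prod_nullWeights, prod_altWeights]
  set A := (1 - weight ε₁ δ₁ ε₂ δ₂) / (Real.exp ε₁ + 1) with hA
  set B := weight ε₁ δ₁ ε₂ δ₂ / (Real.exp ε₂ + 1) with hB
  have hW : outerScale ε₁ δ₁ ε₂ δ₂ ^ (m 0 + m 3) * innerScale ε₁ δ₁ ε₂ δ₂ ^ (m 1 + m 2) =
      (1 - δ₁) ^ k * (A ^ (m 0 + m 3) * B ^ (m 1 + m 2)) := by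
    rw [outerScale, innerScale, ← hA, ← hB, ← hk]
    simp only [mul_pow, pow_add]
    ring
  have hW0 : 0 ≤ outerScale ε₁ δ₁ ε₂ δ₂ ^ (m 0 + m 3) * innerScale ε₁ δ₁ ε₂ δ₂ ^ (m 1 + m 2) :=
    mul_nonneg (pow_nonneg hr _) (pow_nonneg hs _)
  have hexp : Real.exp (slope ε₁ ε₂ k u v) * Real.exp (m 3 * ε₁ + m 2 * ε₂) =
      Real.exp (((m 3 : ℝ) + u + v - k) * ε₁ + ((m 2 : ℝ) + u - v) * ε₂) := by
    rw [← Real.exp_add, slope]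
    congr 1
    ring
  rw [one_mul, mul_left_comm (Real.exp _), hexp, ← mul_min_of_nonneg _ _ hW0, hW]
  split_ifs with h
  · rw [min_eq_right (Real.exp_le_exp.2 (by linarith))]
    ring
  · rw [min_eq_left (Real.exp_le_exp.2 (by linarith))]
    ring

/-- Finitely many supporting lines imply all of them, because the overlap is homogeneous, symmetric,
and piecewise linear with breakpoints only at exponentials of slopes. -/
theorem mem_optimalRegion_iff (hr : 0 ≤ outerScale ε₁ δ₁ ε₂ δ₂)
    (hs : 0 ≤ innerScale ε₁ δ₁ ε₂ δ₂) (hε₂ : 0 ≤ ε₂) (hε : ε₂ < ε₁) {k : ℕ} {z : ℝ × ℝ} :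
    z ∈ optimalRegion ε₁ δ₁ ε₂ δ₂ k ↔ 0 ≤ z.1 ∧ 0 ≤ z.2 ∧ z.1 + z.2 ≤ 1 ∧
      ∀ a b, 0 ≤ a → 0 ≤ b → extremalOverlap ε₁ δ₁ ε₂ δ₂ k a b ≤ a * z.1 + b * z.2 := by
  constructor
  · intro hz
    -- The index set is never empty, so the sign conditions and `z.1 + z.2 ≤ 1` can be read off from
    -- one member.
    have hkk : (k, k) ∈ slopeIndices ε₁ ε₂ k := by
      refine (mem_slopeIndices_iff hε₂ hε).2 ⟨le_rfl, le_rfl, ?_⟩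
      simp only [slope, add_sub_cancel_right, sub_self, mul_zero, add_zero]
      have : 0 ≤ ε₁ := hε₂.trans hε.le
      positivity
    obtain ⟨hx, hy, hxy, -⟩ := hz _ hkk
    refine ⟨hx, hy, hxy, fun a b ha hb => ?_⟩
    have hslope (u v : ℕ) (hu : u ≤ k) (hv : v ≤ k) :
        extremalOverlap ε₁ δ₁ ε₂ δ₂ k 1 (Real.exp (slope ε₁ ε₂ k u v)) ≤
          z.1 + Real.exp (slope ε₁ ε₂ k u v) * z.2 := by
      rcases le_or_gt 0 (slope ε₁ ε₂ k u v) with h | h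
      · obtain ⟨-, -, -, h4, -⟩ := hz (u, v) ((mem_slopeIndices_iff hε₂ hε).2 ⟨hu, hv, h⟩)
        rw [extremalOverlap_slope hr hs]
        simpa using h4
      -- A negative slope is reflected to `(k - u, k - v)`; the second inequality of that
      -- constraint, multiplied by `exp` of the slope, is the required one by homogeneity and
      -- symmetry.
      · have hneg := slope_sub (ε₁ := ε₁) (ε₂ := ε₂) hu hv
        obtain ⟨-, -, -, -, h5⟩ := hz (k - u, k - v) ((mem_slopeIndices_iff hε₂ hε).2
          ⟨k.sub_le u, k.sub_le v, by rw [hneg]; linarith⟩)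
        have h6 := extremalOverlap_slope hr hs k (k - u) (k - v)
        simp only [sub_sub_cancel] at h5
        rw [← h6, hneg] at h5
        have h7 := mul_le_mul_of_nonneg_left h5 (Real.exp_nonneg (slope ε₁ ε₂ k u v))
        have hinv : Real.exp (slope ε₁ ε₂ k u v) * Real.exp (-slope ε₁ ε₂ k u v) = 1 := by
          rw [← Real.exp_add, add_neg_cancel, Real.exp_zero]
        rw [extremalOverlap, ← overlap_mul _ _ _ (Real.exp_nonneg _), hinv, mul_one,
          ← extremalOverlap, extremalOverlap_comm, mul_add, ← mul_assoc, hinv, one_mul] at h7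
        exact h7
    -- `W` is the mass of a sequence under the alternative and `g` its likelihood ratio, so `min P
    -- (t Q) = W * min g t`.
    let W (m : Fin 4 → ℕ) : ℝ := outerScale ε₁ δ₁ ε₂ δ₂ ^ (m 0 + m 3) *
      innerScale ε₁ δ₁ ε₂ δ₂ ^ (m 1 + m 2) * Real.exp (m 3 * ε₁ + m 2 * ε₂)
    let g (m : Fin 4 → ℕ) : ℝ := Real.exp (slope ε₁ ε₂ k (m 0 + m 1) (m 0 + m 2))
    have hW (m : Fin 4 → ℕ) : 0 ≤ W m :=
      mul_nonneg (mul_nonneg (pow_nonneg hr _) (pow_nonneg hs _)) (Real.exp_nonneg _)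
    have hform (t : ℝ) : extremalOverlap ε₁ δ₁ ε₂ δ₂ k 1 t =
        ∑ m ∈ Finset.univ.piAntidiag k,
          (Nat.multinomial Finset.univ m * W m : ℝ) * min (g m) t := by
      rw [extremalOverlap, overlap_eq_sum]
      refine Finset.sum_congr rfl fun m hm => ?_
      have hgm : Real.exp (m 0 * ε₁ + m 1 * ε₂) = Real.exp (m 3 * ε₁ + m 2 * ε₂) * g m := by
        simp only [g]
        rw [slope_of_sum_eq _ _ (Finset.mem_piAntidiag.1 hm).1, ← Real.exp_add]
        congr 1
        ring
      rw [prod_nullWeights, prod_altWeights, hgm, one_mul, ← mul_assoc, mul_comm t,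
        ← mul_min_of_nonneg _ _ (hW m)]
      exact (mul_assoc _ (W m) _).symm
    have hline : ∀ t, 0 ≤ t → extremalOverlap ε₁ δ₁ ε₂ δ₂ k 1 t ≤ z.1 + t * z.2 := by
      intro t ht
      rw [hform]
      refine sum_mul_min_le_of_breakpoints _ _ g (fun m _ => Real.exp_nonneg _) hx hy ?_ ht
      intro m hm
      rw [← hform]
      have hk : ∑ i, m i = k := (Finset.mem_piAntidiag.1 hm).1
      rw [Fin.sum_univ_four] at hk
      exact hslope _ _ (by omega) (by omega)
    rcases ha.eq_or_lt with rfl | ha'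
    · rw [extremalOverlap, overlap_zero_left _ (altWeights_nonneg hr hs) _ hb]
      positivity
    · have h := mul_le_mul_of_nonneg_left (hline (b / a) (div_nonneg hb ha)) ha
      have hba : a * (b / a) = b := mul_div_cancel₀ b ha'.ne'
      rwa [extremalOverlap, ← overlap_mul _ _ _ ha, mul_one, hba, ← extremalOverlap, mul_add,
        ← mul_assoc, hba] at h
  · rintro ⟨hx, hy, hxy, h⟩ ⟨u, v⟩ huv
    have h1 := h 1 _ zero_le_one (Real.exp_nonneg (slope ε₁ ε₂ k u v))
    have h2 := h _ 1 (Real.exp_nonneg (slope ε₁ ε₂ k u v)) zero_le_one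
    rw [extremalOverlap_comm] at h2
    rw [extremalOverlap_slope hr hs, one_mul] at h1 h2
    exact ⟨hx, hy, hxy, by linarith, by linarith⟩

end Scales

/-! ### No composition has a larger region -/

theorem IsDP.privacyRegion_composition_subset {ε₁ δ₁ ε₂ δ₂ : ℝ} (hε₂ : 0 ≤ ε₂) (hε : ε₂ < ε₁)
    (hδ₁ : δ₁ < 1) (hδ : δ₁ ≤ δ₂)
    (hact : δ₂ ≤ δ₁ + (1 - δ₁) * (Real.exp ε₁ - Real.exp ε₂) / (Real.exp ε₁ + 1))
    {X : Type*} {nbr : X → X → Prop} (hsymm : ∀ x x', nbr x x' → nbr x' x)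
    {Y : ℕ → Type*} [∀ i, MeasurableSpace (Y i)] {M : ∀ i, X → Kernel (View Y i) (Y i)} {k : ℕ}
    (hM : ∀ i < k, ∀ x, IsMarkovKernel (M i x))
    (h1 : ∀ i < k, ∀ w, IsDP nbr (fun x => M i x w) ε₁ δ₁)
    (h2 : ∀ i < k, ∀ w, IsDP nbr (fun x => M i x w) ε₂ δ₂) {x x' : X} (hx : nbr x x') :
    privacyRegion (composition M k x) (composition M k x') ⊆ optimalRegion ε₁ δ₁ ε₂ δ₂ k := by
  intro z hz
  have hr := outerScale_nonneg hε hδ₁ hδ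
  have hs := innerScale_nonneg hε hδ₁ hact
  have hsum := scales_sum ε₁ δ₁ ε₂ δ₂
  have hsub := outerScale_mul_sub (δ₂ := δ₂) hε hδ₁
  have hround : ∀ i < k, ∀ w (φ : Y i → ℝ), IsTest φ → ∀ a b, 0 ≤ a → 0 ≤ b →
      ∑ j, min (a * nullWeights ε₁ ε₂ (outerScale ε₁ δ₁ ε₂ δ₂) (innerScale ε₁ δ₁ ε₂ δ₂) j)
        (b * altWeights ε₁ ε₂ (outerScale ε₁ δ₁ ε₂ δ₂) (innerScale ε₁ δ₁ ε₂ δ₂) j) ≤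
      a * typeI (M i x w) φ + b * typeII (M i x' w) φ := by
    intro i hi w φ hφ a b ha hb
    have := hM i hi x
    have := hM i hi x'
    have k1 := le_typeI_add_of_measureReal_le (h1 i hi w x x' hx) hφ
    have k2 := le_typeI_add_of_measureReal_le (h2 i hi w x x' hx) hφ
    have k1' := le_add_typeII_of_measureReal_le (h1 i hi w x' x (hsymm _ _ hx)) hφ
    have k2' := le_add_typeII_of_measureReal_le (h2 i hi w x' x (hsymm _ _ hx)) hφ
    -- By `hsum` and `hsub`, the left sides of the required bounds are `1 - δ₁` and `1 - δ₂`.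
    exact sum_min_weights_le hε₂ hε (by linarith) (by linarith) (by linarith) (by linarith)
      (hφ.integral_mem _).1 (hφ.one_sub.integral_mem _).1 ha hb
  have hlin : ∀ a b, 0 ≤ a → 0 < b →
      extremalOverlap ε₁ δ₁ ε₂ δ₂ k a b ≤ a * z.1 + b * z.2 := fun a b ha hb =>
    le_of_mem_privacyRegion ha hb (fun φ hφ => overlap_le_adaptiveLaw (nullWeights_nonneg hr hs)
      (altWeights_nonneg hr hs) (fun i hi => hM i hi x) (fun i hi => hM i hi x') hround hφ ha hb.le)
      hz
  refine (mem_optimalRegion_iff hr hs hε₂ hε).2 ⟨hz.1, nonneg_of_mem_privacyRegion hz,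
    by linarith [hz.2.2.2], fun a b ha hb => ?_⟩
  -- A bound on the trade-off function requires dividing by `b`; for `b = 0` the overlap vanishes.
  rcases hb.eq_or_lt with rfl | hb
  · rw [extremalOverlap, overlap_zero_right _ (nullWeights_nonneg hr hs) _ ha, zero_mul, add_zero]
    exact mul_nonneg ha hz.1
  · exact hlin a b ha hb

/-! ### Tests on finite spaces -/

/-- On a finite space, every point above the supporting lines of the error set is above the errors
of some test. -/
theorem exists_isTest_of_sum_min_le {Ω : Type*} [Fintype Ω] [MeasurableSpace Ω]
    [MeasurableSingletonClass Ω] (P Q : Measure Ω) [IsProbabilityMeasure P]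
    [IsProbabilityMeasure Q] {x y : ℝ}
    (h : ∀ a b, 0 ≤ a → 0 ≤ b →
      ∑ w, min (a * P.real {w}) (b * Q.real {w}) ≤ a * x + b * y) :
    ∃ φ : Ω → ℝ, IsTest φ ∧ typeI P φ ≤ x ∧ typeII Q φ ≤ y := by
  have htest {φ : Ω → ℝ} (hφ : φ ∈ Set.univ.pi fun _ => Set.Icc (0 : ℝ) 1) : IsTest φ :=
    ⟨measurable_of_finite φ, fun w => hφ w (Set.mem_univ w)⟩
  let S (ν : Measure Ω) : (Ω → ℝ) →L[ℝ] ℝ :=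
    ∑ w, ν.real {w} • ContinuousLinearMap.proj (R := ℝ) (φ := fun _ : Ω => ℝ) w
  have hS (ν : Measure Ω) (φ : Ω → ℝ) : S ν φ = ∑ w, ν.real {w} * φ w := by
    simp [S]
  have hSint (ν : Measure Ω) [IsProbabilityMeasure ν] {φ : Ω → ℝ} (hφ : IsTest φ) :
      ∫ w, φ w ∂ν = S ν φ := by
    rw [integral_fintype (hφ.integrable ν), hS]
    rfl
  let T : (Ω → ℝ) →L[ℝ] ℝ × ℝ := (S P).prod (-S Q)
  by_contra hno
  -- `T` sends a test to its error pair with the second entry lowered by 1, which makes it linear.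
  -- If no test is good enough, the compact convex image of the cube of tests misses a closed
  -- quadrant and is strictly separated from it.
  have hdisj : Disjoint (T '' Set.univ.pi fun _ => Set.Icc (0 : ℝ) 1) (Set.Iic (x, y - 1)) := by
    rw [Set.disjoint_left]
    rintro _ ⟨φ, hφ, rfl⟩ hle
    obtain ⟨hle1, hle2⟩ := Prod.mk_le_mk.1 (Set.mem_Iic.1 hle)
    refine hno ⟨φ, htest hφ, ?_, ?_⟩
    · rw [typeI, hSint P (htest hφ)]
      exact hle1
    · rw [typeII_eq (htest hφ), hSint Q (htest hφ)]
      have : -S Q φ ≤ y - 1 := hle2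
      linarith
  obtain ⟨f, u, v, hfu, huv, hfv⟩ := geometric_hahn_banach_compact_closed
    ((convex_pi fun _ _ => convex_Icc _ _).linear_image T.toLinearMap)
    ((isCompact_univ_pi fun _ => isCompact_Icc).image T.continuous) (convex_Iic _) isClosed_Iic
    hdisj
  have hf (s t : ℝ) : f (s, t) = s * f (1, 0) + t * f (0, 1) := by
    rw [← smul_eq_mul, ← smul_eq_mul, ← map_smul, ← map_smul, ← map_add]
    simp
  have hxy := hfv _ (Set.mem_Iic.2 le_rfl)
  -- The functional is bounded below on a quadrant that is unbounded downwards; with a positive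
  -- coefficient, the chosen point would have value exactly `v`.
  have hneg1 : f (1, 0) ≤ 0 := by
    by_contra! hpos
    have := hfv (x - (f (x, y - 1) - v) / f (1, 0), y - 1) (Set.mem_Iic.2 (Prod.mk_le_mk.2
      ⟨sub_le_self _ (div_nonneg (by linarith) hpos.le), le_rfl⟩))
    rw [hf, sub_mul, div_mul_cancel₀ _ hpos.ne', hf x] at this
    linarith
  have hneg2 : f (0, 1) ≤ 0 := by
    by_contra! hpos
    have := hfv (x, y - 1 - (f (x, y - 1) - v) / f (0, 1)) (Set.mem_Iic.2 (Prod.mk_le_mk.2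
      ⟨le_rfl, sub_le_self _ (div_nonneg (by linarith) hpos.le)⟩))
    rw [hf, sub_mul, div_mul_cancel₀ _ hpos.ne', hf x] at this
    linarith
  have hmain := h _ _ (neg_nonneg.2 hneg1) (neg_nonneg.2 hneg2)
  set a := -f (1, 0) with ha
  set b := -f (0, 1) with hb
  classical
  -- The Bayes test for the weights of the separating functional attains the sum of minima, so the
  -- hypothesis at `(a, b)` contradicts the separation.
  let φ : Ω → ℝ := fun w => if a * P.real {w} ≤ b * Q.real {w} then 1 else 0
  have hφ : φ ∈ Set.univ.pi fun _ => Set.Icc (0 : ℝ) 1 := fun w _ => by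
    simp only [φ]
    split_ifs <;> simp
  have hlt : f (T φ) < f (x, y - 1) := ((hfu _ ⟨φ, hφ, rfl⟩).trans huv).trans hxy
  have hT : T φ = (S P φ, -S Q φ) := rfl
  have hQ1 : ∑ w, Q.real {w} = 1 := by simp
  have hmin : ∑ w, min (a * P.real {w}) (b * Q.real {w}) = a * S P φ + b * (1 - S Q φ) := by
    rw [hS, hS, ← hQ1, ← Finset.sum_sub_distrib, Finset.mul_sum, Finset.mul_sum,
      ← Finset.sum_add_distrib]
    refine Finset.sum_congr rfl fun w _ => ?_
    simp only [φ]
    split_ifs with hw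
    · rw [min_eq_left hw]
      ring
    · rw [min_eq_right (not_le.1 hw).le]
      ring
  rw [hT, hf, hf x] at hlt
  rw [hmin] at hmain
  linarith

theorem mem_privacyRegion_of_isTest {Ω : Type*} [MeasurableSpace Ω] {P Q : Measure Ω}
    {z : ℝ × ℝ} (h1 : 0 ≤ z.1) (h2 : 0 ≤ z.2) (h : z.1 + z.2 ≤ 1) {φ : Ω → ℝ} (hφ : IsTest φ)
    (hI : typeI P φ ≤ z.1) (hII : typeII Q φ ≤ z.2) : z ∈ privacyRegion P Q := by
  refine ⟨h1, by linarith, le_trans (csInf_le ⟨0, ?_⟩ ⟨φ, hφ, hI, rfl⟩) hII, by linarith⟩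
  rintro _ ⟨ψ, hψ, -, rfl⟩
  exact integral_nonneg fun w => sub_nonneg.2 (hψ.2 w).2

/-! ### Self-compositions over a finite alphabet -/

instance View.instFintype (Y : ℕ → Type*) [∀ i, Fintype (Y i)] : ∀ n, Fintype (View Y n)
  | 0 => inferInstanceAs (Fintype PUnit)
  | n + 1 => @instFintypeProd (View Y n) (Y n) (View.instFintype Y n) inferInstance

instance View.instMeasurableSingletonClass (Y : ℕ → Type*) [∀ i, MeasurableSpace (Y i)]
    [∀ i, MeasurableSingletonClass (Y i)] : ∀ n, MeasurableSingletonClass (View Y n)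
  | 0 => inferInstanceAs (MeasurableSingletonClass PUnit)
  | n + 1 =>
    have := View.instMeasurableSingletonClass Y n
    inferInstanceAs (MeasurableSingletonClass (View Y n × Y n))

theorem isProbabilityMeasure_selfComposition {X Z : Type*} [MeasurableSpace Z]
    {M : X → Measure Z} (hM : ∀ x, IsProbabilityMeasure (M x)) (k : ℕ) (x : X) :
    IsProbabilityMeasure (selfComposition M k x) :=
  isProbabilityMeasure_adaptiveLaw fun _ _ => ⟨fun _ => hM x⟩

theorem sum_min_selfComposition {X Z : Type*} [Fintype Z] [MeasurableSpace Z]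
    [MeasurableSingletonClass Z] {M : X → Measure Z} (hM : ∀ x, IsProbabilityMeasure (M x))
    (k : ℕ) (x x' : X) (a b : ℝ) :
    ∑ w, min (a * (selfComposition M k x).real {w}) (b * (selfComposition M k x').real {w}) =
      overlap (fun i => (M x).real {i}) (fun i => (M x').real {i}) k a b := by
  induction k generalizing a b with
  | zero =>
    have hone (y : X) (w : PUnit) : (selfComposition M 0 y).real {w} = 1 := by
      have : (Measure.dirac PUnit.unit : Measure PUnit).real {w} = 1 := by
        rw [show ({w} : Set PUnit) = Set.univ from Set.eq_univ_of_forall fun _ => rfl]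
        exact probReal_univ
      exact this
    refine (Fintype.sum_unique (ι := PUnit) _).trans ?_
    exact congrArg₂ min ((congrArg (a * ·) (hone x _)).trans (mul_one a))
      ((congrArg (b * ·) (hone x' _)).trans (mul_one b))
  | succ k ih =>
    have hprod (y : X) (w : View (fun _ => Z) k) (i : Z) :
        (selfComposition M (k + 1) y).real {(w, i)} =
          (selfComposition M k y).real {w} * (M y).real {i} := by
      have := isProbabilityMeasure_selfComposition hM k y
      have : selfComposition M (k + 1) y = (selfComposition M k y).prod (M y) :=
        Measure.compProd_const
      rw [this]
      refine (congrArg _ Set.singleton_prod_singleton.symm).trans ?_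
      exact measureReal_prod_prod _ _
    simp only [overlap]
    refine (Fintype.sum_prod_type_right (α₁ := View (fun _ => Z) k) (α₂ := Z) _).trans ?_
    refine Finset.sum_congr rfl fun i _ => ?_
    rw [← ih]
    refine Finset.sum_congr rfl fun w _ => ?_
    refine (congrArg₂ min (congrArg (a * ·) (hprod x w i))
      (congrArg (b * ·) (hprod x' w i))).trans ?_
    congr 1 <;> ring

/-! ### The extremal mechanism -/

/-- The measure on `Fin m` with the point masses `r`. -/
noncomputable def finMeasure {m : ℕ} (r : Fin m → ℝ) : Measure (Fin m) :=
  ∑ i, ENNReal.ofReal (r i) • Measure.dirac i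

theorem finMeasure_real {m : ℕ} {r : Fin m → ℝ} (hr : ∀ i, 0 ≤ r i) (S : Set (Fin m)) :
    (finMeasure r).real S = ∑ i, S.indicator r i := by
  classical
  simp only [Measure.real, finMeasure, Measure.coe_finsetSum, Finset.sum_apply,
    Measure.smul_apply, smul_eq_mul]
  rw [ENNReal.toReal_sum fun i _ => ENNReal.mul_ne_top ENNReal.ofReal_ne_top (measure_ne_top _ _)]
  refine Finset.sum_congr rfl fun i _ => ?_
  rw [Measure.dirac_apply]
  by_cases hi : i ∈ S <;> simp [hi, hr i]

theorem finMeasure_real_singleton {m : ℕ} {r : Fin m → ℝ} (hr : ∀ i, 0 ≤ r i) (i : Fin m) :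
    (finMeasure r).real {i} = r i := by
  rw [finMeasure_real hr, Finset.sum_eq_single i] <;> simp +contextual

theorem isProbabilityMeasure_finMeasure {m : ℕ} {r : Fin m → ℝ} (hr : ∀ i, 0 ≤ r i)
    (h1 : ∑ i, r i = 1) : IsProbabilityMeasure (finMeasure r) := by
  refine ⟨?_⟩
  have := finMeasure_real hr Set.univ
  rw [Set.indicator_univ, h1] at this
  exact (ENNReal.toReal_eq_one_iff _).1 this

/-- The sum of positive parts bounds `P S - c Q S` for every event, so privacy of a finite mechanism
reduces to a single sum. -/
theorem finMeasure_real_le {m : ℕ} {r s : Fin m → ℝ} (hr : ∀ i, 0 ≤ r i) (hs : ∀ i, 0 ≤ s i)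
    {c δ : ℝ} (h : ∑ i, max (r i - c * s i) 0 ≤ δ) (S : Set (Fin m)) :
    (finMeasure r).real S ≤ c * (finMeasure s).real S + δ := by
  rw [finMeasure_real hr, finMeasure_real hs, Finset.mul_sum, ← sub_le_iff_le_add',
    ← Finset.sum_sub_distrib]
  refine (Finset.sum_le_sum fun i _ => ?_).trans h
  by_cases hi : i ∈ S <;> simp [hi]

/-- The point masses of the extremal mechanism: its outcomes reveal the database with probability
`δ₁`, and are otherwise a mixture of randomized responses of levels `ε₁` and `ε₂`. -/
noncomputable def extremalMass (ε₁ δ₁ ε₂ δ₂ : ℝ) : Fin 6 → ℝ :=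
  ![δ₁, outerScale ε₁ δ₁ ε₂ δ₂ * Real.exp ε₁, innerScale ε₁ δ₁ ε₂ δ₂ * Real.exp ε₂,
    innerScale ε₁ δ₁ ε₂ δ₂, outerScale ε₁ δ₁ ε₂ δ₂, 0]

/-- The point masses of the extremal mechanism on each of the two databases. -/
noncomputable def extremalMasses (ε₁ δ₁ ε₂ δ₂ : ℝ) (x : Bool) (i : Fin 6) : ℝ :=
  extremalMass ε₁ δ₁ ε₂ δ₂ (cond x i i.rev)

section Extremal

variable {ε₁ δ₁ ε₂ δ₂ : ℝ}

theorem extremalMass_nonneg (hδ₁ : 0 ≤ δ₁) (hr : 0 ≤ outerScale ε₁ δ₁ ε₂ δ₂)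
    (hs : 0 ≤ innerScale ε₁ δ₁ ε₂ δ₂) (i : Fin 6) : 0 ≤ extremalMass ε₁ δ₁ ε₂ δ₂ i := by
  fin_cases i <;> simp [extremalMass] <;> positivity

theorem sum_extremalMasses (x : Bool) : ∑ i, extremalMasses ε₁ δ₁ ε₂ δ₂ x i = 1 := by
  have h : ∑ i, extremalMass ε₁ δ₁ ε₂ δ₂ i = 1 := by
    rw [Fin.sum_univ_six]
    simp only [extremalMass, Matrix.cons_val]
    linarith [scales_sum ε₁ δ₁ ε₂ δ₂]
  cases x
  · exact (Equiv.sum_comp Fin.revPerm (extremalMass ε₁ δ₁ ε₂ δ₂)).trans h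
  · exact h

theorem sum_max_extremalMasses {x x' : Bool} (hx : x ≠ x') (c : ℝ) :
    ∑ i, max (extremalMasses ε₁ δ₁ ε₂ δ₂ x i - c * extremalMasses ε₁ δ₁ ε₂ δ₂ x' i) 0 =
      ∑ i, max (extremalMass ε₁ δ₁ ε₂ δ₂ i - c * extremalMass ε₁ δ₁ ε₂ δ₂ i.rev) 0 := by
  cases x <;> cases x'
  · exact absurd rfl hx
  · rw [← Equiv.sum_comp Fin.revPerm]
    simp [extremalMasses]
  · rfl
  · exact absurd rfl hx

/-- For `c` between `exp ε₂` and `exp ε₁`, only the revealing outcome and the one with likelihood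
ratio `exp ε₁` can contribute. -/
theorem sum_max_extremalMass_le (hδ₁ : 0 ≤ δ₁) (hr : 0 ≤ outerScale ε₁ δ₁ ε₂ δ₂)
    (hs : 0 ≤ innerScale ε₁ δ₁ ε₂ δ₂) (hε₂ : 0 ≤ ε₂) {c : ℝ}
    (hc : Real.exp ε₂ ≤ c) (hc' : c ≤ Real.exp ε₁) :
    ∑ i, max (extremalMass ε₁ δ₁ ε₂ δ₂ i - c * extremalMass ε₁ δ₁ ε₂ δ₂ i.rev) 0 ≤
      δ₁ + outerScale ε₁ δ₁ ε₂ δ₂ * (Real.exp ε₁ - c) := by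
  have h1 : 1 ≤ Real.exp ε₂ := Real.one_le_exp hε₂
  have r0 : Fin.rev (0 : Fin 6) = 5 := rfl
  have r1 : Fin.rev (1 : Fin 6) = 4 := rfl
  have r2 : Fin.rev (2 : Fin 6) = 3 := rfl
  have r3 : Fin.rev (3 : Fin 6) = 2 := rfl
  have r4 : Fin.rev (4 : Fin 6) = 1 := rfl
  have r5 : Fin.rev (5 : Fin 6) = 0 := rfl
  rw [Fin.sum_univ_six, r0, r1, r2, r3, r4, r5]
  simp only [extremalMass, Matrix.cons_val]
  set r := outerScale ε₁ δ₁ ε₂ δ₂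
  set s := innerScale ε₁ δ₁ ε₂ δ₂
  rw [max_eq_left (by linarith : (0 : ℝ) ≤ δ₁ - c * 0),
    max_eq_left (by nlinarith : 0 ≤ r * Real.exp ε₁ - c * r),
    max_eq_right (by nlinarith : s * Real.exp ε₂ - c * s ≤ 0),
    max_eq_right (by
      have : 1 ≤ c * Real.exp ε₂ := by nlinarith
      nlinarith : s - c * (s * Real.exp ε₂) ≤ 0),
    max_eq_right (by
      have : 1 ≤ c * Real.exp ε₁ := by nlinarith
      nlinarith : r - c * (r * Real.exp ε₁) ≤ 0),
    max_eq_right (by nlinarith : 0 - c * δ₁ ≤ 0)]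
  exact le_of_eq (by ring)

theorem extremalMasses_nonneg (hδ₁ : 0 ≤ δ₁) (hr : 0 ≤ outerScale ε₁ δ₁ ε₂ δ₂)
    (hs : 0 ≤ innerScale ε₁ δ₁ ε₂ δ₂) (x : Bool) (i : Fin 6) :
    0 ≤ extremalMasses ε₁ δ₁ ε₂ δ₂ x i :=
  extremalMass_nonneg hδ₁ hr hs _

/-- Both required constraints are endpoints of this family: the offset is δ₁ at `ε = ε₁` and, by
`outerScale_mul_sub`, δ₂ at `ε = ε₂`. -/
theorem isDP_extremal (hδ₁ : 0 ≤ δ₁) (hr : 0 ≤ outerScale ε₁ δ₁ ε₂ δ₂)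
    (hs : 0 ≤ innerScale ε₁ δ₁ ε₂ δ₂) (hε₂ : 0 ≤ ε₂) {ε : ℝ}
    (h2 : ε₂ ≤ ε) (h1 : ε ≤ ε₁) :
    IsDP (fun x x' => x ≠ x') (fun x => finMeasure (extremalMasses ε₁ δ₁ ε₂ δ₂ x)) ε
      (δ₁ + outerScale ε₁ δ₁ ε₂ δ₂ * (Real.exp ε₁ - Real.exp ε)) := fun x x' hx S _ =>
  finMeasure_real_le (extremalMasses_nonneg hδ₁ hr hs x) (extremalMasses_nonneg hδ₁ hr hs x')
    ((sum_max_extremalMasses hx _).trans_le (sum_max_extremalMass_le hδ₁ hr hs hε₂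
      (Real.exp_le_exp.2 h2) (Real.exp_le_exp.2 h1))) S

theorem overlap_extremalMasses (hδ₁ : 0 ≤ δ₁) (hr : 0 ≤ outerScale ε₁ δ₁ ε₂ δ₂)
    (hs : 0 ≤ innerScale ε₁ δ₁ ε₂ δ₂) {x x' : Bool} (hx : x ≠ x') (k : ℕ) {a b : ℝ}
    (ha : 0 ≤ a) (hb : 0 ≤ b) :
    overlap (extremalMasses ε₁ δ₁ ε₂ δ₂ x) (extremalMasses ε₁ δ₁ ε₂ δ₂ x') k a b =
      extremalOverlap ε₁ δ₁ ε₂ δ₂ k a b := by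
  have key : ∀ a b, 0 ≤ a → 0 ≤ b →
      overlap (extremalMasses ε₁ δ₁ ε₂ δ₂ true) (extremalMasses ε₁ δ₁ ε₂ δ₂ false) k a b =
        extremalOverlap ε₁ δ₁ ε₂ δ₂ k a b := by
    intro a b ha hb
    -- The first and last outcomes each reveal the database and drop out; the middle four carry the
    -- extremal weights.
    rw [overlap_eq_of_zero (extremalMasses_nonneg hδ₁ hr hs _)
      (extremalMasses_nonneg hδ₁ hr hs _) rfl rfl k ha hb, extremalOverlap]
    congr 1 <;> ext i <;> fin_cases i <;> rfl
  cases x <;> cases x'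
  · exact absurd rfl hx
  · rw [overlap_swap, key b a hb ha, extremalOverlap_comm]
  · exact key a b ha hb
  · exact absurd rfl hx

theorem optimalRegion_subset_privacyRegion (hδ₁ : 0 ≤ δ₁) (hr : 0 ≤ outerScale ε₁ δ₁ ε₂ δ₂)
    (hs : 0 ≤ innerScale ε₁ δ₁ ε₂ δ₂) (hε₂ : 0 ≤ ε₂) (hε : ε₂ < ε₁) (k : ℕ) {x x' : Bool}
    (hx : x ≠ x') :
    optimalRegion ε₁ δ₁ ε₂ δ₂ k ⊆
      privacyRegion
        (selfComposition (fun x => finMeasure (extremalMasses ε₁ δ₁ ε₂ δ₂ x)) k x)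
        (selfComposition (fun x => finMeasure (extremalMasses ε₁ δ₁ ε₂ δ₂ x)) k x') := by
  intro z hz
  obtain ⟨h1, h2, h12, hlin⟩ := (mem_optimalRegion_iff hr hs hε₂ hε).1 hz
  have hM (y : Bool) : IsProbabilityMeasure (finMeasure (extremalMasses ε₁ δ₁ ε₂ δ₂ y)) :=
    isProbabilityMeasure_finMeasure (extremalMasses_nonneg hδ₁ hr hs y) (sum_extremalMasses y)
  have := isProbabilityMeasure_selfComposition hM k x
  have := isProbabilityMeasure_selfComposition hM k x'
  obtain ⟨φ, hφ, hI, hII⟩ := exists_isTest_of_sum_min_le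
    (selfComposition (fun x => finMeasure (extremalMasses ε₁ δ₁ ε₂ δ₂ x)) k x)
    (selfComposition (fun x => finMeasure (extremalMasses ε₁ δ₁ ε₂ δ₂ x)) k x')
    (x := z.1) (y := z.2) fun a b ha hb => by
      rw [sum_min_selfComposition hM]
      simp only [finMeasure_real_singleton (extremalMasses_nonneg hδ₁ hr hs _)]
      exact (overlap_extremalMasses hδ₁ hr hs hx k ha hb).trans_le (hlin a b ha hb)
  exact mem_privacyRegion_of_isTest h1 h2 h12 hφ hI hII

end Extremal

end TwoDP

theorem mainTheorem2 (ε₁ δ₁ ε₂ δ₂ : ℝ) (k : ℕ)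
    (hε₂ : 0 ≤ ε₂) (hε : ε₂ < ε₁) (hδ₁ : 0 ≤ δ₁) (hδ₁' : δ₁ < 1) (hδ : δ₁ ≤ δ₂)
    (hact : δ₂ ≤ δ₁ + (1 - δ₁) * (Real.exp ε₁ - Real.exp ε₂) / (Real.exp ε₁ + 1)) :
    -- the listed pairs `(u, v)` are exactly those whose slope is non-negative
    (∀ a b : ℕ, (a, b) ∈ TwoDP.slopeIndices ε₁ ε₂ k ↔
      a ≤ k ∧ b ≤ k ∧ 0 ≤ TwoDP.slope ε₁ ε₂ k a b) ∧
    -- some mechanism under the two constraints has the region as its `k`-fold composition region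
    (∃ (m : ℕ) (M : Bool → Measure (Fin m)), (∀ x, IsProbabilityMeasure (M x)) ∧
      TwoDP.IsDP (fun x x' => x ≠ x') M ε₁ δ₁ ∧ TwoDP.IsDP (fun x x' => x ≠ x') M ε₂ δ₂ ∧
      ∀ x x' : Bool, x ≠ x' →
        TwoDP.privacyRegion (TwoDP.selfComposition M k x) (TwoDP.selfComposition M k x') =
          TwoDP.optimalRegion ε₁ δ₁ ε₂ δ₂ k) ∧
    -- no adaptive composition of mechanisms under the two constraints has a larger region
    (∀ (X : Type u) (nbr : X → X → Prop) (_ : ∀ x x', nbr x x' → nbr x' x)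
      (Y : ℕ → Type v) (_ : ∀ i, MeasurableSpace (Y i))
      (M : ∀ i, X → Kernel (TwoDP.View Y i) (Y i)),
      (∀ i < k, ∀ x, IsMarkovKernel (M i x)) →
      (∀ i < k, ∀ w, TwoDP.IsDP nbr (fun x => M i x w) ε₁ δ₁) →
      (∀ i < k, ∀ w, TwoDP.IsDP nbr (fun x => M i x w) ε₂ δ₂) →
      ∀ x x', nbr x x' →
        TwoDP.privacyRegion (TwoDP.composition M k x) (TwoDP.composition M k x') ⊆
          TwoDP.optimalRegion ε₁ δ₁ ε₂ δ₂ k) := by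
  have hr := TwoDP.outerScale_nonneg hε hδ₁' hδ
  have hs := TwoDP.innerScale_nonneg hε hδ₁' hact
  refine ⟨fun a b => TwoDP.mem_slopeIndices_iff hε₂ hε, ?_, ?_⟩
  · have hM (x : Bool) :
        IsProbabilityMeasure (TwoDP.finMeasure (TwoDP.extremalMasses ε₁ δ₁ ε₂ δ₂ x)) :=
      TwoDP.isProbabilityMeasure_finMeasure (TwoDP.extremalMasses_nonneg hδ₁ hr hs x)
        (TwoDP.sum_extremalMasses x)
    have h1 := TwoDP.isDP_extremal hδ₁ hr hs hε₂ hε.le le_rfl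
    rw [sub_self, mul_zero, add_zero] at h1
    have h2 := TwoDP.isDP_extremal hδ₁ hr hs hε₂ le_rfl hε.le
    rw [TwoDP.outerScale_mul_sub hε hδ₁', add_sub_cancel] at h2
    refine ⟨6, fun x => TwoDP.finMeasure (TwoDP.extremalMasses ε₁ δ₁ ε₂ δ₂ x), hM, h1, h2,
      fun x x' hx => Set.Subset.antisymm ?_
        (TwoDP.optimalRegion_subset_privacyRegion hδ₁ hr hs hε₂ hε k hx)⟩
    -- Self-composition is the adaptive composition with constant kernels, so the general upper
    -- bound gives this inclusion.
    exact TwoDP.IsDP.privacyRegion_composition_subset hε₂ hε hδ₁' hδ hact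
      (fun _ _ => Ne.symm) (fun _ _ x => ⟨fun _ => hM x⟩) (fun _ _ _ => h1) (fun _ _ _ => h2) hx
  · intro X nbr hsymm Y _ M hM h1 h2 x x' hx
    exact TwoDP.IsDP.privacyRegion_composition_subset hε₂ hε hδ₁' hδ hact hsymm hM h1 h2 hx
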